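/- Write $\mathbb{N}=\{1,2,3,\dots\}$. For a finite set $\mathcal{A}$ (with the discrete topology) and $d\in\mathbb{N}$, let $\mathcal{A}^{\mathbb{Z}^d}$ carry the product topology and the shift action of $\mathbb{Z}^d$ given by $(g\cdot x)_a = x_{a+g}$ for $a,g\in\mathbb{Z}^d$. Let $\mathrm{Aut}^{(\infty)}(\mathcal{A}^{\mathbb{Z}^d},\mathbb{Z}^d)$ denote the stabilized automorphism group: the group, under composition, of all homeomorphisms $\varphi\colon \mathcal{A}^{\mathbb{Z}^d}\to\mathcal{A}^{\mathbb{Z}^d}$ for which there is a finite index subgroup $H\subset\mathbb{Z}^d$ such that $\varphi(g\cdot x)=g\cdot\varphi(x)$ for all $g\in H$ and $x\in\mathcal{A}^{\mathbb{Z}^d}$. **Theorem.** Let $d_1,d_2\in\mathbb{N}$ and let $\mathcal{A},\mathcal{B}$ be finite alphabets, each with at least two elements. The groups $\mathrm{Aut}^{(\infty)}(\mathcal{A}^{\mathbb{Z}^{d_1}},\mathbb{Z}^{d_1})$ and $\mathrm{Aut}^{(\infty)}(\mathcal{B}^{\mathbb{Z}^{d_2}},\mathbb{Z}^{d_2})$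 are isomorphic if and only if $d_1=d_2$ and there exist $m,n\in\mathbb{N}$ such that $|\mathcal{A}|^m=|\mathcal{B}|^n$. -/

import Mathlib

/-- The automorphism group of the system obtained by restricting a `G`-action on `X` to a
subgroup `H`: the self-homeomorphisms of `X` that commute with the action of every `g ∈ H`. -/
def systemAut {G X : Type*} [AddGroup G] [TopologicalSpace X] [AddAction G X]
    (H : AddSubgroup G) : Subgroup (X ≃ₜ X) where
  carrier := {φ | ∀ g ∈ H, ∀ x : X, φ (g +ᵥ x) = g +ᵥ φ x}
  one_mem' := fun _ _ _ => rfl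
  mul_mem' := by
    intro φ ψ hφ hψ g hg x
    change φ (ψ (g +ᵥ x)) = g +ᵥ φ (ψ x)
    rw [hψ g hg, hφ g hg]
  inv_mem' := by
    intro φ hφ g hg x
    change φ.symm (g +ᵥ x) = g +ᵥ φ.symm x
    rw [φ.symm_apply_eq, hφ g hg, φ.apply_symm_apply]

/-- The stabilized automorphism group of a system `(X, G)`: the union of the automorphism groups
of the systems `(X, H)` over all finite index subgroups `H` of `G`. -/
def stabilizedAut (G X : Type*) [AddGroup G] [TopologicalSpace X] [AddAction G X] :
    Subgroup (X ≃ₜ X) where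
  carrier := {φ | ∃ H : AddSubgroup G, H.FiniteIndex ∧ φ ∈ systemAut (X := X) H}
  one_mem' := ⟨⊤, inferInstance, one_mem _⟩
  mul_mem' := by
    rintro φ ψ ⟨H, hH, hφ⟩ ⟨K, hK, hψ⟩
    exact ⟨H ⊓ K, inferInstance,
      mul_mem (fun g hg => hφ g hg.1) (fun g hg => hψ g hg.2)⟩
  inv_mem' := by
    rintro φ ⟨H, hH, hφ⟩
    exact ⟨H, hH, inv_mem hφ⟩

/-- The space `A ^ G` of configurations of the full `A`-shift over `G`. -/
def FullShift (A G : Type*) : Type _ := G → A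

/-- The product topology on `A ^ G`, where `A` carries the discrete topology. -/
instance FullShift.instTopologicalSpace (A G : Type*) : TopologicalSpace (FullShift A G) :=
  @Pi.topologicalSpace G (fun _ => A) (fun _ => ⊥)

/-- The shift action `(g • x) a = x (a + g)`. -/
instance FullShift.instAddAction (A G : Type*) [AddGroup G] : AddAction G (FullShift A G) where
  vadd g x := fun a => x (a + g)
  zero_vadd x := funext fun a => congrArg x (add_zero a)
  add_vadd g h x := funext fun a => congrArg x (add_assoc a g h).symm

/-! Shifts are visible, up to powers, in the abstract group: every element commutes with a positive
power of each shift, and conversely an element with this property has a positive power that is a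
shift (`exists_pow_eq_shiftAut`). So an isomorphism Φ matches finite index subgroups L and L' of
shifts (`finiteIndex_commonShifts`), and injectivity on L gives the equality of dimensions
(`rank_le_of_mulEquiv`).

Φ also carries the centralizer of L, which is `systemAut L`, into `systemAut L'`. The former
contains the symmetric group on the |A|^[G₁:L] patterns on G₁/L; the latter acts on the at most
|B|^[G₂:L'] points fixed by L'. If the alternating group acts nontrivially, the symmetric group
embeds and |A|^[G₁:L] ≤ |B|^[G₂:L'] (`card_pow_index_le`). For nontriviality, fix in advance a
balanced gate, which is even among the patterns on G₁/L for all L ≤ E, and a periodic point moved by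
its image (`exists_periodic_ne`); then shrink L and L' accordingly. Symmetry gives equality.

Conversely, regrouping over isomorphic sublattices of index m and n turns both systems into full
shifts on equally large alphabets (`nonempty_mulEquiv_of_addEquiv`). -/

namespace FullShift

variable {A B G L : Type*}

/-! ### Continuity as dependence on finite windows -/

section Topology

theorem continuousAt_iff_local {f : FullShift A G → FullShift B L} {x : FullShift A G} :
    ContinuousAt f x ↔
      ∀ l, ∃ N : Finset G, ∀ y : FullShift A G, (∀ n ∈ N, y n = x n) → f y l = f x l := by
  let _ : TopologicalSpace A := ⊥
  let _ : TopologicalSpace B := ⊥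
  have : DiscreteTopology A := ⟨rfl⟩
  have : DiscreteTopology B := ⟨rfl⟩
  have h1 : ContinuousAt f x ↔ ∀ l, ∀ᶠ y in nhds x, f y l = f x l := by
    refine (continuousAt_pi (A := fun _ : L => B)).trans (forall_congr' fun l => ?_)
    rw [ContinuousAt, nhds_discrete B, Filter.tendsto_pure]
  rw [h1]
  refine forall_congr' fun l => ?_
  constructor
  · intro h
    obtain ⟨U, hU, hUo, hxU⟩ := mem_nhds_iff.1 h
    obtain ⟨N, u, hu, hN⟩ := (isOpen_pi_iff (A := fun _ : G => A)).1 hUo x hxU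
    refine ⟨N, fun y hy => hU (hN fun n hn => ?_)⟩
    rw [hy n hn]
    exact (hu n hn).2
  · rintro ⟨N, hN⟩
    refine Filter.mem_of_superset (set_pi_mem_nhds (A := fun _ : G => A) (s := fun g => {x g})
      N.finite_toSet fun g _ => ?_) fun y hy => hN y fun n hn => hy n hn
    exact (isOpen_discrete _).mem_nhds rfl

theorem continuous_iff_local {f : FullShift A G → FullShift B L} :
    Continuous f ↔ ∀ x l, ∃ N : Finset G, ∀ y : FullShift A G,
      (∀ n ∈ N, y n = x n) → f y l = f x l :=
  continuous_iff_continuousAt.trans (forall_congr' fun _ => continuousAt_iff_local)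

/-- A map whose value at each cell is determined by a single cell of the argument is continuous. -/
theorem continuous_of_cell {f : FullShift A G → FullShift B L} (r : L → G)
    (h : ∀ x y l, y (r l) = x (r l) → f y l = f x l) : Continuous f :=
  continuous_iff_local.2 fun x l => ⟨{r l}, fun y hy => h x y l (hy _ (by simp))⟩

end Topology

theorem vadd_apply [AddGroup G] (g : G) (x : FullShift A G) (a : G) : (g +ᵥ x) a = x (a + g) :=
  rfl

/-! ### Shifts inside the stabilized automorphism group -/

section Shift

variable [AddCommGroup G]

/-- The shift by `g` as a homeomorphism. -/
def shift (A : Type*) (g : G) : FullShift A G ≃ₜ FullShift A G where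
  toEquiv := AddAction.toPerm g
  continuous_toFun := continuous_of_cell (fun l => l + g) fun _ _ _ h => h
  continuous_invFun := continuous_of_cell (fun l => l + -g) fun _ _ _ h => h

theorem shift_add (g h : G) : shift A (g + h) = shift A g * shift A h :=
  Homeomorph.ext fun x => add_vadd g h x

theorem shift_zero : shift A (0 : G) = 1 :=
  Homeomorph.ext fun x => zero_vadd G x

theorem shift_mem_systemAut (H : AddSubgroup G) (g : G) : shift A g ∈ systemAut H := by
  intro h _ x
  change g +ᵥ (h +ᵥ x) = h +ᵥ (g +ᵥ x)
  rw [vadd_vadd, vadd_vadd, add_comm]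

theorem mem_systemAut_iff_commute {H : AddSubgroup G} {φ : FullShift A G ≃ₜ FullShift A G} :
    φ ∈ systemAut H ↔ ∀ g ∈ H, Commute φ (shift A g) :=
  forall₂_congr fun _ _ => ⟨fun h => Homeomorph.ext h, fun h x => congrArg (fun ψ => ψ x) h.eq⟩

theorem shift_injective [Nontrivial A] : Function.Injective (shift A : G → _) := by
  classical
  intro v w h
  by_contra hne
  obtain ⟨a, b, hab⟩ := exists_pair_ne A
  let x : FullShift A G := fun g => if g = v then a else b
  have hx : ∀ g, x g = if g = v then a else b := fun _ => rfl
  have h1 : x (0 + v) = x (0 + w) := congrFun (congrArg (fun ψ => ψ x) h) 0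
  rw [zero_add, zero_add, hx, hx, if_pos rfl, if_neg (Ne.symm hne)] at h1
  exact hab h1

/-- The shift by `g` as an element of the stabilized automorphism group. -/
def shiftAut (A : Type*) (g : G) : stabilizedAut G (FullShift A G) :=
  ⟨shift A g, ⊤, inferInstance, shift_mem_systemAut _ _⟩

theorem shiftAut_add (g h : G) : shiftAut A (g + h) = shiftAut A g * shiftAut A h :=
  Subtype.ext (shift_add g h)

theorem shiftAut_zero : shiftAut A (0 : G) = 1 := Subtype.ext shift_zero

theorem shiftAut_nsmul (n : ℕ) (g : G) : shiftAut A (n • g) = shiftAut A g ^ n := by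
  induction n with
  | zero => rw [zero_nsmul, shiftAut_zero, pow_zero]
  | succ n ih => rw [succ_nsmul, shiftAut_add, ih, pow_succ]

theorem shiftAut_neg (g : G) : shiftAut A (-g) = (shiftAut A g)⁻¹ := by
  rw [eq_inv_iff_mul_eq_one, ← shiftAut_add, neg_add_cancel, shiftAut_zero]

theorem shiftAut_injective [Nontrivial A] : Function.Injective (shiftAut A : G → _) :=
  fun _ _ h => shift_injective (congrArg Subtype.val h)

/-- Every element of the stabilized automorphism group commutes with some positive power of each
shift. -/
theorem exists_commute_shiftAut_pow (φ : stabilizedAut G (FullShift A G)) (g : G) :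
    ∃ n : ℕ, 0 < n ∧ Commute φ (shiftAut A g ^ n) := by
  obtain ⟨φ, H, hH, hφ⟩ := φ
  refine ⟨H.index, Nat.pos_of_ne_zero hH.index_ne_zero, ?_⟩
  rw [← shiftAut_nsmul]
  exact Subtype.ext (mem_systemAut_iff_commute.1 hφ _ (H.nsmul_index_mem g)).eq

end Shift

/-! ### Cellwise permutations and regrouping over a subgroup -/

section Cellwise

/-- Apply the permutation `p g` of the alphabet in the cell `g`. -/
def gate (p : G → Equiv.Perm A) : FullShift A G ≃ₜ FullShift A G where
  toFun x := fun g => p g (x g)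
  invFun x := fun g => (p g).symm (x g)
  left_inv x := funext fun g => (p g).symm_apply_apply (x g)
  right_inv x := funext fun g => (p g).apply_symm_apply (x g)
  continuous_toFun := continuous_of_cell id fun _ _ l h => congrArg (p l) h
  continuous_invFun := continuous_of_cell id fun _ _ l h => congrArg (p l).symm h

theorem gate_apply (p : G → Equiv.Perm A) (x : FullShift A G) (g : G) :
    gate p x g = p g (x g) := rfl

variable [AddCommGroup G]

theorem gate_mem_systemAut (H : AddSubgroup G) (p : G → Equiv.Perm A)
    (hp : ∀ h ∈ H, ∀ g, p (g + h) = p g) : gate p ∈ systemAut H := by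
  intro h hh x
  funext g
  change p g (x (g + h)) = p (g + h) (x (g + h))
  rw [hp h hh]

/-- The decomposition of a group into translates of a subgroup. -/
noncomputable def cosetEquiv (L : AddSubgroup G) : L × (G ⧸ L) ≃ G :=
  Equiv.ofBijective (fun p => Quotient.out p.2 + (p.1 : G)) <| by
    have hq : ∀ p : L × (G ⧸ L), ((Quotient.out p.2 + (p.1 : G) : G) : G ⧸ L) = p.2 := by
      rintro ⟨l, t⟩
      rw [QuotientAddGroup.mk_add, (QuotientAddGroup.eq_zero_iff _).2 l.2, add_zero]
      exact QuotientAddGroup.out_eq' t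
    constructor
    · intro p q h
      have h2 : p.2 = q.2 := by rw [← hq p, ← hq q]; exact congrArg _ h
      obtain ⟨l, t⟩ := p
      obtain ⟨l', t'⟩ := q
      dsimp only at h h2
      subst h2
      rw [Subtype.ext (add_left_cancel h)]
    · intro g
      refine ⟨⟨⟨-Quotient.out (g : G ⧸ L) + g, ?_⟩, g⟩, by simp⟩
      rw [← QuotientAddGroup.eq]
      exact QuotientAddGroup.out_eq' _

theorem cosetEquiv_mk (L : AddSubgroup G) (p : L × (G ⧸ L)) :
    (cosetEquiv L p : G ⧸ L) = p.2 := by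
  change ((Quotient.out p.2 + (p.1 : G) : G) : G ⧸ L) = p.2
  rw [QuotientAddGroup.mk_add, (QuotientAddGroup.eq_zero_iff _).2 p.1.2, add_zero]
  exact QuotientAddGroup.out_eq' _

theorem cosetEquiv_add (L : AddSubgroup G) (l m : L) (t : G ⧸ L) :
    cosetEquiv L (l, t) + m = cosetEquiv L (l + m, t) :=
  add_assoc _ _ _

/-- Reading a configuration over `G` as a configuration over a subgroup `L`, whose cells hold the
contents of one cell of each coset. -/
noncomputable def regroup (A : Type*) (L : AddSubgroup G) :
    FullShift A G ≃ FullShift (G ⧸ L → A) L where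
  toFun x := fun l t => x (cosetEquiv L (l, t))
  invFun y := fun g => y ((cosetEquiv L).symm g).1 ((cosetEquiv L).symm g).2
  left_inv x := funext fun g => congrArg x ((cosetEquiv L).apply_symm_apply g)
  right_inv y := by funext l t; simp

/-- Finite index is essential here: one new cell reads one old cell from every coset. The inverse
reads a single cell and needs no finiteness. -/
theorem continuous_regroup (L : AddSubgroup G) [L.FiniteIndex] : Continuous (regroup A L) := by
  classical
  let _ : Fintype (G ⧸ L) := L.fintypeQuotientOfFiniteIndex
  refine continuous_iff_local.2 fun x l =>
    ⟨Finset.univ.image fun t => cosetEquiv L (l, t), fun y hy => funext fun t => hy _ ?_⟩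
  exact Finset.mem_image_of_mem _ (Finset.mem_univ _)

theorem continuous_regroup_symm (L : AddSubgroup G) : Continuous (regroup A L).symm :=
  continuous_of_cell (fun g => ((cosetEquiv L).symm g).1) fun _ _ _ h => congrFun h _

/-- `regroup` as a homeomorphism. -/
noncomputable def regroupHomeo (A : Type*) (L : AddSubgroup G) [L.FiniteIndex] :
    FullShift A G ≃ₜ FullShift (G ⧸ L → A) L where
  toEquiv := regroup A L
  continuous_toFun := continuous_regroup L
  continuous_invFun := continuous_regroup_symm L

theorem regroupHomeo_apply (L : AddSubgroup G) [L.FiniteIndex] (x : FullShift A G) (l : L)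
    (t : G ⧸ L) : regroupHomeo A L x l t = x (cosetEquiv L (l, t)) := rfl

theorem regroupHomeo_vadd (L : AddSubgroup G) [L.FiniteIndex] (l : L) (x : FullShift A G) :
    regroupHomeo A L ((l : G) +ᵥ x) = l +ᵥ regroupHomeo A L x := by
  funext m t
  exact congrArg x (cosetEquiv_add L m l t)

theorem regroupHomeo_symm_vadd (L : AddSubgroup G) [L.FiniteIndex] (l : L)
    (y : FullShift (G ⧸ L → A) L) :
    (regroupHomeo A L).symm (l +ᵥ y) = (l : G) +ᵥ (regroupHomeo A L).symm y := by
  rw [Homeomorph.symm_apply_eq, regroupHomeo_vadd, Homeomorph.apply_symm_apply]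

/-- An automorphism of the regrouped shift, as an automorphism over the subgroup. -/
theorem conj_regroup_mem_systemAut (L : AddSubgroup G) [L.FiniteIndex]
    {ψ : FullShift (G ⧸ L → A) L ≃ₜ FullShift (G ⧸ L → A) L}
    (hψ : ∀ (l : L) y, ψ (l +ᵥ y) = l +ᵥ ψ y) :
    ((regroupHomeo A L).trans ψ).trans (regroupHomeo A L).symm ∈ systemAut L := by
  intro g hg x
  change (regroupHomeo A L).symm (ψ (regroupHomeo A L (g +ᵥ x)))
    = g +ᵥ (regroupHomeo A L).symm (ψ (regroupHomeo A L x))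
  rw [show g = ((⟨g, hg⟩ : L) : G) from rfl, regroupHomeo_vadd, hψ, regroupHomeo_symm_vadd]

/-- The permutations of the patterns on `G ⧸ L` act on the configurations over `G` by
automorphisms that commute with the shifts in `L`. -/
noncomputable def patternAut (A : Type*) (L : AddSubgroup G) [L.FiniteIndex] :
    Equiv.Perm (G ⧸ L → A) →* systemAut (X := FullShift A G) L where
  toFun σ := ⟨((regroupHomeo A L).trans (gate fun _ => σ)).trans (regroupHomeo A L).symm,
    conj_regroup_mem_systemAut L fun _ _ => rfl⟩
  map_one' := Subtype.ext <| Homeomorph.ext fun x => (regroupHomeo A L).symm_apply_apply x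
  map_mul' σ τ := Subtype.ext <| Homeomorph.ext fun x => by
    change (regroupHomeo A L).symm (gate (fun _ => σ * τ) (regroupHomeo A L x)) =
      (regroupHomeo A L).symm (gate (fun _ => σ) (regroupHomeo A L ((regroupHomeo A L).symm
        (gate (fun _ => τ) (regroupHomeo A L x)))))
    rw [Homeomorph.apply_symm_apply]
    rfl

theorem regroupHomeo_patternAut (L : AddSubgroup G) [L.FiniteIndex] (σ : Equiv.Perm (G ⧸ L → A))
    (x : FullShift A G) (l : L) :
    regroupHomeo A L ((patternAut A L σ : FullShift A G ≃ₜ FullShift A G) x) l =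
      σ (regroupHomeo A L x l) := by
  change regroupHomeo A L ((regroupHomeo A L).symm
    (gate (fun _ => σ) (regroupHomeo A L x))) l = _
  rw [Homeomorph.apply_symm_apply]
  rfl

end Cellwise

end FullShift

/-! ### Rigidity: maps commuting with partial shifts and gates -/

namespace FullShift

variable {B T L : Type*}

/-- A functional on the functions `L → B` that is compatible with all binary operations of `B`
applied cellwise and that is continuous at the constant functions is the evaluation in a cell. -/
theorem exists_eval_of_map_binary [Nontrivial B] (f : (L → B) → B)
    (hc : ∀ e : B, f (fun _ => e) = e)
    (hf : ∀ (h : B → B → B) (a b : L → B), f (fun l => h (a l) (b l)) = h (f a) (f b))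
    (hloc : ∀ e : B, ∃ N : Finset L, ∀ a : L → B, (∀ n ∈ N, a n = e) → f a = e) :
    ∃ g, ∀ a, f a = a g := by
  classical
  obtain ⟨o, i, hoi⟩ := exists_pair_ne B
  obtain ⟨N, hN⟩ := hloc o
  by_contra! hne
  choose a ha using hne
  -- `h` is conjunction for the truth values `i` and `o`. The indicator of the cells where `a g`
  -- equals `f (a g)` has `f`-value `i` but is `o` at `g`. Conjunctions of such indicators are `o`
  -- on any prescribed finite set, contradicting continuity at the constant `o`: a principal
  -- ultrafilter argument.
  let h : B → B → B := fun u v => if u = i ∧ v = i then i else o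
  have key : ∀ S : Finset L, ∃ b : L → B, f b = i ∧ ∀ g ∈ S, b g = o := by
    intro S
    induction S using Finset.induction_on with
    | empty => exact ⟨fun _ => i, hc i, by simp⟩
    | insert g S _ ih =>
      obtain ⟨b, hb, hbS⟩ := ih
      let e : B → B → B := fun u _ => if u = f (a g) then i else o
      refine ⟨fun l => h (e (a g l) (a g l)) (b l), ?_, ?_⟩
      · rw [hf h (fun l => e (a g l) (a g l)) b, hf e, hb]
        simp [h, e]
      · intro k hk
        rcases Finset.mem_insert.1 hk with rfl | hk
        · simp [h, e, (ha k).symm, hoi]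
        · simp [h, hbS k hk, hoi]
  obtain ⟨b, hb, hbN⟩ := key N
  exact hoi ((hN b hbN).symm.trans hb)

variable [AddCommGroup L]

/-- Shift the track `t` by `h`, and leave the other tracks as they are. -/
def partialShift [DecidableEq T] (B : Type*) (t : T) (h : L) :
    FullShift (T → B) L ≃ₜ FullShift (T → B) L where
  toFun y := fun l s => if s = t then y (l + h) s else y l s
  invFun y := fun l s => if s = t then y (l - h) s else y l s
  left_inv y := by funext l s; by_cases hs : s = t <;> simp [hs]
  right_inv y := by funext l s; by_cases hs : s = t <;> simp [hs]
  continuous_toFun := by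
    classical
    refine continuous_iff_local.2 fun x l => ⟨{l, l + h}, fun y hy => ?_⟩
    funext s
    rw [hy l (by simp), hy (l + h) (by simp)]
  continuous_invFun := by
    classical
    refine continuous_iff_local.2 fun x l => ⟨{l, l - h}, fun y hy => ?_⟩
    funext s
    rw [hy l (by simp), hy (l - h) (by simp)]

theorem partialShift_apply [DecidableEq T] (t : T) (h : L) (y : FullShift (T → B) L) (l : L)
    (s : T) : partialShift B t h y l s = if s = t then y (l + h) s else y l s := rfl

theorem partialShift_vadd [DecidableEq T] (t : T) (h : L) (l : L) (y : FullShift (T → B) L) :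
    partialShift B t h (l +ᵥ y) = l +ᵥ partialShift B t h y := by
  funext m s
  change (if s = t then y (m + h + l) s else y (m + l) s) =
    if s = t then y (m + l + h) s else y (m + l) s
  rw [add_right_comm]

theorem partialShift_iterate [DecidableEq T] (t : T) (h : L) (y : FullShift (T → B) L) (j : ℕ)
    (l : L) (s : T) :
    ((partialShift B t h)^[j]) y l s = if s = t then y (l + j • h) s else y l s := by
  induction j generalizing y with
  | zero => simp
  | succ j ih =>
    rw [Function.iterate_succ_apply, ih, partialShift_apply, partialShift_apply]
    by_cases hs : s = t
    · simp only [hs, if_true, succ_nsmul, add_assoc]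
    · simp only [hs, if_false]

/-- A continuous map that commutes with a partial shift of the track `t` does not let the track `t`
influence the other ones. -/
theorem apply_eq_of_commute_partialShift [DecidableEq T]
    {z : FullShift (T → B) L → FullShift (T → B) L} (hz : Continuous z) {h : L}
    (hh : ∀ n : ℕ, n • h = 0 → n = 0) {t : T}
    (hcomm : ∀ y, z (partialShift B t h y) = partialShift B t h (z y))
    {x y : FullShift (T → B) L} (hxy : ∀ l, ∀ s ≠ t, x l s = y l s) (l : L) {s : T} (hs : s ≠ t) :
    z x l s = z y l s := by
  classical
  obtain ⟨N, hN⟩ := continuous_iff_local.1 hz x l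
  obtain ⟨M, hM⟩ := continuous_iff_local.1 hz y l
  have hinj : Function.Injective fun j : ℕ => j • h := by
    intro i j hij
    dsimp only at hij
    wlog hle : i ≤ j generalizing i j
    · exact (this hij.symm (le_of_not_ge hle)).symm
    obtain ⟨k, rfl⟩ := Nat.exists_eq_add_of_le hle
    rw [add_nsmul, left_eq_add] at hij
    rw [hh k hij, add_zero]
  -- As `h` has infinite order, some multiple of it moves the window `M` off the window `N`.
  obtain ⟨j, hj⟩ : ∃ j : ℕ, ∀ n ∈ N, ∀ m ∈ M, m + j • h ≠ n := by
    obtain ⟨j, hj⟩ := ((N ×ˢ M).image fun p => p.1 - p.2).finite_toSet.preimage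
      (f := fun j : ℕ => j • h) hinj.injOn |>.exists_notMem
    refine ⟨j, fun n hn m hm hmn => hj ?_⟩
    simp only [Set.mem_preimage, Finset.mem_coe, Finset.mem_image, Finset.mem_product,
      Prod.exists]
    exact ⟨n, m, ⟨hn, hm⟩, by rw [← hmn, add_sub_cancel_left]⟩
  -- `w` looks like `x` on `N`, and like `y` on `M` once track `t` is shifted `j` times. That shift
  -- commutes with `z` and leaves the tracks `s ≠ t` of the output alone.
  let w : FullShift (T → B) L := fun k r =>
    if r = t then (if k ∈ N then x k r else y (k - j • h) r) else x k r
  have hw : ∀ k r, w k r = if r = t then (if k ∈ N then x k r else y (k - j • h) r) else x k r :=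
    fun _ _ => rfl
  have h1 : z w l = z x l := hN w fun n hn => by
    funext r
    rw [hw, if_pos hn, ite_self]
  have h2 : z ((partialShift B t h)^[j] w) l = z y l := hM _ fun m hm => by
    funext r
    rw [partialShift_iterate, hw, hw]
    by_cases hr : r = t
    · have : m + j • h ∉ N := fun hmem => hj _ hmem m hm rfl
      simp only [hr, if_true, this, if_false, add_sub_cancel_right]
    · simp only [hr, if_false]
      exact hxy m r hr
  have h3 : z ((partialShift B t h)^[j] w) = (partialShift B t h)^[j] (z w) :=
    (Function.Semiconj.iterate_right (f := z) (ga := partialShift B t h)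
      (gb := partialShift B t h) hcomm j) w
  rw [← h1, ← h2, h3, partialShift_iterate, if_neg hs]

/-- The permutation of patterns that adds `h (y u) (y v)` to the entry at `w`. -/
def addControlled [DecidableEq T] [AddGroup B] {u v w : T} (hu : u ≠ w) (hv : v ≠ w)
    (h : B → B → B) : Equiv.Perm (T → B) where
  toFun y := Function.update y w (y w + h (y u) (y v))
  invFun y := Function.update y w (y w - h (y u) (y v))
  left_inv y := by simp [hu, hv]
  right_inv y := by simp [hu, hv]

theorem addControlled_apply_self [DecidableEq T] [AddGroup B] {u v w : T} (hu : u ≠ w) (hv : v ≠ w)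
    (h : B → B → B) (y : T → B) : addControlled hu hv h y w = y w + h (y u) (y v) :=
  Function.update_self ..

/-- A continuous map on configurations with at least three tracks that commutes with the shift,
with all cellwise permutations, and with an infinite order partial shift of each track is a power
of the shift. -/
theorem eq_shift_of_commute [DecidableEq T] [Finite T] (hT : 3 ≤ Nat.card T) [AddCommGroup B]
    [Nontrivial B] {z : FullShift (T → B) L → FullShift (T → B) L} (hz : Continuous z) {h : L}
    (hh : ∀ n : ℕ, n • h = 0 → n = 0)
    (hshift : ∀ (l : L) y, z (l +ᵥ y) = l +ᵥ z y)
    (hpart : ∀ t y, z (partialShift B t h y) = partialShift B t h (z y))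
    (hgate : ∀ (σ : Equiv.Perm (T → B)) y, z (gate (fun _ => σ) y) = gate (fun _ => σ) (z y)) :
    ∃ g : L, ∀ y, z y = g +ᵥ y := by
  classical
  let _ : Fintype T := Fintype.ofFinite T
  -- Each output track depends only on the same input track: the other tracks are replaced one at a
  -- time.
  have hindep : ∀ (w : T) (S : Finset T), w ∉ S → ∀ x y : FullShift (T → B) L,
      (∀ l, ∀ s ∉ S, x l s = y l s) → z x 0 w = z y 0 w := by
    intro w S
    induction S using Finset.induction_on with
    | empty =>
      intro _ x y hxy
      rw [show x = y from funext fun l => funext fun s => hxy l s (by simp)]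
    | insert t S _ ih =>
      intro hw x y hxy
      rw [Finset.mem_insert, not_or] at hw
      let m : FullShift (T → B) L := fun l s => if s = t then y l s else x l s
      have hm : ∀ l s, m l s = if s = t then y l s else x l s := fun _ _ => rfl
      rw [apply_eq_of_commute_partialShift hz hh (hpart t) (y := m)
        (fun l s hs => by rw [hm, if_neg hs]) 0 hw.1]
      refine ih hw.2 m y fun l s hs => ?_
      rw [hm]
      by_cases hst : s = t
      · rw [if_pos hst]
      · rw [if_neg hst, hxy l s (by simp [hs, hst])]
  let f : T → (L → B) → B := fun w a => z (fun l _ => a l) 0 w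
  have hzf : ∀ w (y : FullShift (T → B) L), z y 0 w = f w fun l => y l w := fun w y =>
    hindep w (Finset.univ.erase w) (by simp) _ _ fun l s hs => by
      have : s = w := by simpa using hs
      rw [this]
  have hthird : ∀ w u : T, ∃ v, v ≠ w ∧ v ≠ u := by
    intro w u
    by_contra! hcon
    have : Fintype.card T ≤ ({w, u} : Finset T).card := Finset.card_le_card fun v _ => by
      by_cases hv : v = w
      · simp [hv]
      · simp [hcon v hv]
    have h2 := Finset.card_le_two (a := w) (b := u)
    rw [Nat.card_eq_fintype_card] at hT
    omega
  have hctrl : ∀ {u v w : T}, u ≠ w → v ≠ w → u ≠ v → ∀ (k : B → B → B) (a b c : L → B),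
      f w (fun l => c l + k (a l) (b l)) = f w c + k (f u a) (f v b) := by
    intro u v w hu hv huv k a b c
    let y : FullShift (T → B) L := fun l s => if s = w then c l else if s = u then a l else b l
    have hyw : ∀ l, y l w = c l := fun l => if_pos rfl
    have hyu : ∀ l, y l u = a l := fun l => (if_neg hu).trans (if_pos rfl)
    have hyv : ∀ l, y l v = b l := fun l => (if_neg hv).trans (if_neg huv.symm)
    have h1 := congrFun (congrFun (hgate (addControlled hu hv k) y) 0) w
    rw [gate_apply, addControlled_apply_self, hzf, hzf, hzf, hzf] at h1
    simp only [gate_apply, addControlled_apply_self, hyw, hyu, hyv] at h1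
    exact h1
  -- Otherwise take for `k` a function that vanishes at `0` but not at `f u 0`: the controlled
  -- addition is trivial on the zero input but not on the output.
  have hzero : ∀ u, f u (fun _ => 0) = 0 := by
    intro u
    by_contra hne
    obtain ⟨w, hw, -⟩ := hthird u u
    obtain ⟨v, hvu, hvw⟩ := hthird u w
    obtain ⟨o, ho⟩ := exists_ne (0 : B)
    have h1 := hctrl hw.symm hvw hvu.symm (fun a _ => if a = f u (fun _ => 0) then o else 0)
      (fun _ => 0) (fun _ => 0) (fun _ => 0)
    simp only [if_neg (Ne.symm hne), add_zero, if_true] at h1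
    exact ho (left_eq_add.1 h1)
  have hbin : ∀ {u v w : T}, u ≠ w → v ≠ w → u ≠ v → ∀ (k : B → B → B) (a b : L → B),
      f w (fun l => k (a l) (b l)) = k (f u a) (f v b) := by
    intro u v w hu hv huv k a b
    have h1 := hctrl hu hv huv k a b (fun _ => 0)
    simpa only [zero_add, hzero] using h1
  -- The first projection as `k` copies track `u` to track `w`; the second control sits on a third
  -- track, hence the need for three tracks.
  have hsame : ∀ u w, f u = f w := by
    intro u w
    by_cases huw : u = w
    · rw [huw]
    · obtain ⟨v, hvw, hvu⟩ := hthird w u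
      funext a
      exact (hbin huw hvw hvu.symm (fun a _ => a) a a).symm
  have hne : Nonempty T := (Nat.card_pos_iff.1 (by omega)).1
  obtain ⟨w⟩ := hne
  obtain ⟨u, huw, -⟩ := hthird w w
  obtain ⟨v, hvw, hvu⟩ := hthird w u
  have hconst : ∀ e : B, f w (fun _ => e) = e := fun e =>
    hbin huw hvw hvu.symm (fun _ _ => e) (fun _ => e) (fun _ => e)
  obtain ⟨g, hg⟩ := exists_eval_of_map_binary (f w) hconst
    (fun k a b => by rw [hbin huw hvw hvu.symm, hsame u w, hsame v w]) (fun e => by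
      obtain ⟨N, hN⟩ := continuous_iff_local.1 hz (fun _ _ => e) 0
      refine ⟨N, fun a ha => ?_⟩
      have h1 := hN (fun l _ => a l) fun n hn => funext fun _ => ha n hn
      exact (congrFun h1 w).trans (hconst e))
  refine ⟨g, fun y => ?_⟩
  funext l s
  have h1 : z y l s = z (l +ᵥ y) 0 s := by
    rw [hshift, vadd_apply, zero_add]
  rw [h1, hzf, hsame s w, hg, vadd_apply, vadd_apply, add_comm]

end FullShift

/-! ### Recognizing shifts by commutation -/

namespace FullShift

variable {A B G : Type*} [AddCommGroup G]

theorem index_le_index_of_le {H K : AddSubgroup G} (h : H ≤ K) [H.FiniteIndex] :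
    K.index ≤ H.index :=
  Nat.le_of_dvd (Nat.pos_of_ne_zero AddSubgroup.FiniteIndex.index_ne_zero)
    (AddSubgroup.index_dvd_of_le h)

/-- An element of the stabilized automorphism group such that every element commutes with one of
its powers has a power that is a shift. -/
theorem exists_pow_eq_shiftAut [Finite B] [Nontrivial B] [IsAddTorsionFree G] [Nontrivial G]
    {E : AddSubgroup G} [E.FiniteIndex] (hE : 3 ≤ E.index) (z : stabilizedAut G (FullShift B G))
    (hz : ∀ φ, ∃ n : ℕ, 0 < n ∧ Commute φ (z ^ n)) :
    ∃ n : ℕ, 0 < n ∧ ∃ g, z ^ n = shiftAut B g := by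
  classical
  obtain ⟨H, hH, hzH⟩ := z.2
  obtain ⟨L, hL, hLH, hL3⟩ : ∃ L : AddSubgroup G, L.FiniteIndex ∧ L ≤ H ∧ 3 ≤ L.index :=
    ⟨H ⊓ E, inferInstance, inf_le_left, hE.trans (index_le_index_of_le inf_le_right)⟩
  -- Any group structure on the alphabet will do; it only serves to define controlled additions.
  have : NeZero (Nat.card B) := ⟨Nat.card_pos.ne'⟩
  let _ : AddCommGroup B := (Finite.equivFin B).addCommGroup
  have hT : 3 ≤ Nat.card (G ⧸ L) := hL3
  obtain ⟨v, hv⟩ := exists_ne (0 : G)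
  let h : L := ⟨L.index • v, L.nsmul_index_mem v⟩
  have hh : ∀ n : ℕ, n • h = 0 → n = 0 := by
    intro n hn
    have h1 : n • L.index • v = 0 := congrArg Subtype.val hn
    rw [smul_smul, smul_eq_zero_iff_left hv] at h1
    exact (Nat.mul_eq_zero.1 h1).resolve_right (by omega)
  let R := regroupHomeo B L
  let ψ : (G ⧸ L) ⊕ Equiv.Perm (G ⧸ L → B) →
      (FullShift (G ⧸ L → B) L ≃ₜ FullShift (G ⧸ L → B) L) :=
    Sum.elim (fun t => partialShift B t h) fun σ => gate fun _ => σ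
  have hψ : ∀ i (l : L) y, ψ i (l +ᵥ y) = l +ᵥ ψ i y := by
    rintro (t | σ) l y
    · exact partialShift_vadd t h l y
    · rfl
  -- Finitely many test elements suffice, so the product of their exponents gives one power of `z`
  -- commuting with all of them.
  let φ : (G ⧸ L) ⊕ Equiv.Perm (G ⧸ L → B) → stabilizedAut G (FullShift B G) := fun i =>
    ⟨(R.trans (ψ i)).trans R.symm, L, hL, conj_regroup_mem_systemAut L (hψ i)⟩
  choose n hn hcomm using fun i => hz (φ i)
  let _ := Fintype.ofFinite ((G ⧸ L) ⊕ Equiv.Perm (G ⧸ L → B))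
  refine ⟨∏ i, n i, Finset.prod_pos fun i _ => hn i, ?_⟩
  have hN : ∀ i, Commute (φ i) (z ^ ∏ i, n i) := fun i => by
    obtain ⟨k, hk⟩ := Finset.dvd_prod_of_mem n (Finset.mem_univ i)
    rw [hk, pow_mul]
    exact (hcomm i).pow_right k
  obtain ⟨w, hw⟩ : ∃ w, w = z ^ ∏ i, n i := ⟨_, rfl⟩
  rw [← hw] at hN ⊢
  have hwL : (w : FullShift B G ≃ₜ FullShift B G) ∈ systemAut L := by
    rw [hw, SubgroupClass.coe_pow]
    exact pow_mem (show z.1 ∈ systemAut L from fun g hg x => hzH g (hLH hg) x) _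
  have hcm : ∀ i y, R (w.1 (R.symm (ψ i y))) = ψ i (R (w.1 (R.symm y))) := by
    intro i y
    have h1 : R.symm (ψ i (R (w.1 (R.symm y)))) = w.1 (R.symm (ψ i (R (R.symm y)))) :=
      congrArg (fun a : stabilizedAut G (FullShift B G) => a.1 (R.symm y)) (hN i).eq
    rw [R.apply_symm_apply] at h1
    rw [← h1, R.apply_symm_apply]
  obtain ⟨g, hg⟩ := eq_shift_of_commute hT (z := fun y => R (w.1 (R.symm y)))
    (R.continuous.comp (w.1.continuous.comp R.symm.continuous)) hh
    (fun l y => by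
      change R (w.1 (R.symm (l +ᵥ y))) = l +ᵥ R (w.1 (R.symm y))
      rw [regroupHomeo_symm_vadd, hwL _ l.2, regroupHomeo_vadd])
    (fun t y => hcm (Sum.inl t) y) (fun σ y => hcm (Sum.inr σ) y)
  refine ⟨g, Subtype.ext (Homeomorph.ext fun x => ?_)⟩
  have h1 := hg (R x)
  rw [R.symm_apply_apply, ← regroupHomeo_vadd] at h1
  exact R.injective h1

/-! ### Periodic points -/

section Periodic

/-- Applied to the differences of a finite window, this makes the window inject into the quotient,
so that every pattern on it extends periodically. -/
theorem exists_finiteIndex_forall_mem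
    (hres : ∀ v : G, v ≠ 0 → ∃ H : AddSubgroup G, H.FiniteIndex ∧ v ∉ H) (N : Finset G) :
    ∃ M : AddSubgroup G, M.FiniteIndex ∧ ∀ n ∈ N, n ∈ M → n = 0 := by
  classical
  induction N using Finset.induction_on with
  | empty => exact ⟨⊤, inferInstance, by simp⟩
  | insert v N _ ih =>
    obtain ⟨M, hM, hN⟩ := ih
    by_cases hv : v = 0
    · exact ⟨M, hM, fun n hn hnM => (Finset.mem_insert.1 hn).elim (fun h => h.trans hv)
        fun h => hN n h hnM⟩
    · obtain ⟨H, hH, hvH⟩ := hres v hv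
      refine ⟨M ⊓ H, inferInstance, fun n hn hnM => ?_⟩
      rcases Finset.mem_insert.1 hn with rfl | hn
      · exact absurd hnM.2 hvH
      · exact hN n hn hnM.1

/-- A subgroup contains its index times `v`; if it avoids `v` and `2 • v`, its index is neither 1
nor 2. -/
theorem exists_finiteIndex_three_le_index [IsAddTorsionFree G] [Nontrivial G]
    (hres : ∀ v : G, v ≠ 0 → ∃ H : AddSubgroup G, H.FiniteIndex ∧ v ∉ H) :
    ∃ E : AddSubgroup G, E.FiniteIndex ∧ 3 ≤ E.index := by
  classical
  obtain ⟨v, hv⟩ := exists_ne (0 : G)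
  obtain ⟨E, hE, hN⟩ := exists_finiteIndex_forall_mem hres {1 • v, 2 • v}
  refine ⟨E, hE, ?_⟩
  have h0 := hE.index_ne_zero
  have hmem := E.nsmul_index_mem v
  by_contra! hlt
  have : E.index = 1 ∨ E.index = 2 := by omega
  rcases this with h | h <;> rw [h] at hmem <;> have h1 := hN _ (by simp) hmem <;>
    simp [hv] at h1

/-- A nontrivial homeomorphism of a full shift moves a periodic point. -/
theorem exists_periodic_ne [Nonempty B]
    (hres : ∀ v : G, v ≠ 0 → ∃ H : AddSubgroup G, H.FiniteIndex ∧ v ∉ H)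
    {φ : FullShift B G ≃ₜ FullShift B G} (hφ : φ ≠ 1) :
    ∃ M : AddSubgroup G, M.FiniteIndex ∧
      ∃ x : FullShift B G, (∀ g ∈ M, g +ᵥ x = x) ∧ φ x ≠ x := by
  classical
  obtain ⟨x, hx⟩ : ∃ x, φ x ≠ x := by
    by_contra! h
    exact hφ (Homeomorph.ext h)
  obtain ⟨v, hv⟩ := Function.ne_iff.1 hx
  obtain ⟨N, hN⟩ := continuous_iff_local.1 φ.continuous x v
  let N' := insert v N
  obtain ⟨M, hM, hMN⟩ := exists_finiteIndex_forall_mem hres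
    ((N' ×ˢ N').image fun p => p.1 - p.2)
  -- The pattern of `x` on `N'`, pushed to the quotient; it is well defined by the choice of `M`,
  -- and the filler elsewhere is irrelevant.
  let r : G ⧸ M → B := fun t => if h : ∃ n ∈ N', (n : G ⧸ M) = t then x h.choose
    else Classical.arbitrary B
  have hr : ∀ n ∈ N', r (n : G ⧸ M) = x n := by
    intro n hn
    have hex : ∃ m ∈ N', (m : G ⧸ M) = n := ⟨n, hn, rfl⟩
    have h1 : r (n : G ⧸ M) = x hex.choose := dif_pos hex
    have h2 := hMN (n - hex.choose) (Finset.mem_image.2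
      ⟨(n, hex.choose), Finset.mem_product.2 ⟨hn, hex.choose_spec.1⟩, rfl⟩) (by
        rw [sub_eq_neg_add]
        exact QuotientAddGroup.eq.1 hex.choose_spec.2)
    rw [h1, ← sub_eq_zero.1 h2]
  let y : FullShift B G := fun g => r g
  have hy : ∀ n ∈ N', y n = x n := hr
  refine ⟨M, hM, y, fun g hg => ?_, fun hφy => hv ?_⟩
  · funext a
    change r ((a + g : G) : G ⧸ M) = r a
    rw [QuotientAddGroup.mk_add, (QuotientAddGroup.eq_zero_iff g).2 hg, add_zero]
  · rw [← hN y fun n hn => hy n (Finset.mem_insert_of_mem hn), hφy,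
      hy v (Finset.mem_insert_self _ _)]

/-- The points that are fixed by all shifts in `L`. -/
abbrev Fix (B : Type*) (L : AddSubgroup G) : Type _ :=
  {x : FullShift B G // ∀ g ∈ L, g +ᵥ x = x}

theorem fix_restrict_injective (L : AddSubgroup G) :
    Function.Injective fun (x : Fix B L) (t : G ⧸ L) => x.1 (Quotient.out t) := by
  intro x y hxy
  refine Subtype.ext (funext fun g => ?_)
  have hm : -Quotient.out (g : G ⧸ L) + g ∈ L :=
    QuotientAddGroup.eq.1 (QuotientAddGroup.out_eq' (g : G ⧸ L))
  have key : ∀ x : Fix B L, x.1 g = x.1 (Quotient.out (g : G ⧸ L)) := fun x => by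
    have := congrFun (x.2 _ hm) (Quotient.out (g : G ⧸ L))
    rw [vadd_apply, add_neg_cancel_left] at this
    exact this
  rw [key, key]
  exact congrFun hxy (g : G ⧸ L)

instance [Finite B] (L : AddSubgroup G) [L.FiniteIndex] : Finite (Fix B L) :=
  Finite.of_injective _ (fix_restrict_injective L)

theorem card_fix_le [Finite B] (L : AddSubgroup G) [L.FiniteIndex] :
    Nat.card (Fix B L) ≤ Nat.card B ^ L.index := by
  refine (Nat.card_le_card_of_injective _ (fix_restrict_injective L)).trans_eq ?_
  rw [Nat.card_fun]
  rfl

/-- The automorphisms over `L` permute the points fixed by `L`. -/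
def fixAction (B : Type*) (L : AddSubgroup G) :
    systemAut (X := FullShift B G) L →* Equiv.Perm (Fix B L) where
  toFun φ :=
    { toFun := fun x => ⟨φ.1 x.1, fun g hg => by rw [← φ.2 g hg, x.2 g hg]⟩
      invFun := fun x => ⟨φ.1.symm x.1, fun g hg => by
        rw [Homeomorph.eq_symm_apply, φ.2 g hg, Homeomorph.apply_symm_apply, x.2 g hg]⟩
      left_inv := fun x => Subtype.ext (φ.1.symm_apply_apply x.1)
      right_inv := fun x => Subtype.ext (φ.1.apply_symm_apply x.1) }
  map_one' := rfl
  map_mul' _ _ := rfl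

end Periodic

/-! ### Balanced gates and the symmetric group on patterns -/

section Balanced

open scoped commutatorElement

open scoped Classical in
/-- The permutation `π` in the cells of `E`, and the identity elsewhere. -/
noncomputable def cosetPerm (E : AddSubgroup G) (π : Equiv.Perm A) (e : G ⧸ E) : Equiv.Perm A :=
  if e = 0 then π else 1

/-- The permutation `π` in the cells of `E`, and its inverse in the cells of another coset. -/
noncomputable def balancedGate (E : AddSubgroup G) (π : Equiv.Perm A) (g₀ : G) :
    FullShift A G ≃ₜ FullShift A G :=
  gate fun g => cosetPerm E π (g : G ⧸ E) * (cosetPerm E π ((g + g₀ : G) : G ⧸ E))⁻¹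

theorem balancedGate_mem_systemAut (E : AddSubgroup G) (π : Equiv.Perm A) (g₀ : G) :
    balancedGate E π g₀ ∈ systemAut E := by
  refine gate_mem_systemAut _ _ fun h hh g => ?_
  rw [add_right_comm g h, QuotientAddGroup.mk_add _ g h, QuotientAddGroup.mk_add _ (g + g₀) h,
    (QuotientAddGroup.eq_zero_iff h).2 hh, add_zero, add_zero]

theorem balancedGate_ne_one {E : AddSubgroup G} {π : Equiv.Perm A} (hπ : π ≠ 1) {g₀ : G}
    (hg₀ : g₀ ∉ E) : balancedGate E π g₀ ≠ 1 := by
  intro h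
  refine hπ (Equiv.ext fun a => ?_)
  let x : FullShift A G := fun _ => a
  have h1 : balancedGate E π g₀ x 0 = a := congrFun (congrArg (fun ψ => ψ x) h) 0
  rw [balancedGate, gate_apply, zero_add, cosetPerm, cosetPerm, QuotientAddGroup.mk_zero,
    if_pos rfl, if_neg (mt (QuotientAddGroup.eq_zero_iff g₀).1 hg₀), inv_one, mul_one] at h1
  exact h1

/-- The translation of patterns on `G ⧸ L` by `t`. -/
def translatePattern (A : Type*) {T : Type*} [AddGroup T] (t : T) : Equiv.Perm (T → A) where
  toFun y := fun s => y (s + t)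
  invFun y := fun s => y (s - t)
  left_inv y := by simp
  right_inv y := by simp

/-- A balanced gate is a commutator of pattern permutations, hence an even one. -/
theorem exists_commutator_eq_balancedGate {E L : AddSubgroup G} [L.FiniteIndex] (hLE : L ≤ E)
    (π : Equiv.Perm A) (g₀ : G) :
    ∃ σ τ : Equiv.Perm (G ⧸ L → A), (patternAut A L ⁅σ, τ⁆).1 = balancedGate E π g₀ := by
  let q : G ⧸ L → Equiv.Perm A := fun t =>
    cosetPerm E π (QuotientAddGroup.map L E (AddMonoidHom.id G) hLE t)
  -- Conjugating the inverse of the gate by the translation moves it by `g₀`, which gives the second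
  -- factor.
  refine ⟨Equiv.piCongrRight q, translatePattern A (g₀ : G ⧸ L), Homeomorph.ext fun x => ?_⟩
  refine (regroupHomeo A L).injective (funext fun l => funext fun t => ?_)
  rw [regroupHomeo_patternAut, regroupHomeo_apply, balancedGate, gate_apply]
  have hq : ∀ g : G, cosetPerm E π (g : G ⧸ E) = q (g : G ⧸ L) := fun g => rfl
  rw [hq, hq, QuotientAddGroup.mk_add, cosetEquiv_mk]
  change q t ((q (t + (g₀ : G ⧸ L)))⁻¹ (regroupHomeo A L x l (t + (g₀ : G ⧸ L) - (g₀ : G ⧸ L)))) = _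
  rw [add_sub_cancel_right]
  rfl

/-- If the automorphisms over `L` act on a finite set so that a balanced gate acts nontrivially,
then this set has at least as many elements as there are patterns on `G ⧸ L`. -/
theorem card_pow_index_le [Finite A] [Nontrivial A] {E L : AddSubgroup G} [L.FiniteIndex]
    (hLE : L ≤ E) (hL : 3 ≤ L.index) (π : Equiv.Perm A) (g₀ : G) {P : Type*} [Finite P]
    (f : systemAut (X := FullShift A G) L →* Equiv.Perm P) {s : systemAut (X := FullShift A G) L}
    (hs : s.1 = balancedGate E π g₀) (hfs : f s ≠ 1) : Nat.card A ^ L.index ≤ Nat.card P := by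
  classical
  let _ : Fintype (G ⧸ L → A) := Fintype.ofFinite _
  have hcard : Nat.card (G ⧸ L → A) = Nat.card A ^ L.index := by
    rw [Nat.card_fun]
    rfl
  have h5 : 5 ≤ Nat.card (G ⧸ L → A) := by
    rw [hcard]
    calc 5 ≤ 2 ^ 3 := by norm_num
      _ ≤ Nat.card A ^ 3 := Nat.pow_le_pow_left Finite.one_lt_card 3
      _ ≤ Nat.card A ^ L.index := Nat.pow_le_pow_right Nat.card_pos hL
  obtain ⟨σ, τ, hστ⟩ := exists_commutator_eq_balancedGate hLE π g₀
  let F := f.comp (patternAut A L)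
  -- With at least five patterns, a nontrivial normal subgroup contains the alternating group, hence
  -- the commutator; but the balanced gate acts nontrivially.
  have hinj : Function.Injective F := by
    rw [← MonoidHom.ker_eq_bot_iff]
    by_contra hne
    have hle := Equiv.Perm.alternatingGroup_le_of_normal h5
      ((Subgroup.nontrivial_iff_ne_bot F.ker).2 hne)
    refine hfs ?_
    have h1 : F ⁅σ, τ⁆ = 1 := hle (by
      rw [Equiv.Perm.mem_alternatingGroup, map_commutatorElement,
        commutatorElement_eq_one_iff_mul_comm, mul_comm])
    rwa [show s = patternAut A L ⁅σ, τ⁆ from Subtype.ext (hs.trans hστ.symm)]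
  have h2 := Nat.card_le_card_of_injective F hinj
  rw [Nat.card_perm, Nat.card_perm, hcard] at h2
  rw [hcard] at h5
  by_contra! hlt
  have h3 := Nat.factorial_le (Nat.le_sub_one_of_lt hlt)
  have h4 : (Nat.card A ^ L.index - 1).factorial < (Nat.card A ^ L.index).factorial :=
    (Nat.factorial_lt (by omega)).2 (by omega)
  omega

end Balanced

end FullShift

namespace FullShift

/-! ### Transfer along an isomorphism -/

section Forward

variable {A B G₁ G₂ : Type*} [AddCommGroup G₁] [AddCommGroup G₂]

/-- The shifts in `J` that an isomorphism maps to shifts in `J'`. -/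
def commonShifts (Φ : stabilizedAut G₁ (FullShift A G₁) ≃* stabilizedAut G₂ (FullShift B G₂))
    (J : AddSubgroup G₁) (J' : AddSubgroup G₂) : AddSubgroup G₁ where
  carrier := {v | v ∈ J ∧ ∃ w ∈ J', Φ (shiftAut A v) = shiftAut B w}
  zero_mem' := ⟨J.zero_mem, 0, J'.zero_mem, by rw [shiftAut_zero, shiftAut_zero, map_one]⟩
  add_mem' := by
    rintro v v' ⟨hv, w, hw, h⟩ ⟨hv', w', hw', h'⟩
    exact ⟨J.add_mem hv hv', w + w', J'.add_mem hw hw', by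
      rw [shiftAut_add, shiftAut_add, map_mul, h, h']⟩
  neg_mem' := by
    rintro v ⟨hv, w, hw, h⟩
    exact ⟨J.neg_mem hv, -w, J'.neg_mem hw, by rw [shiftAut_neg, shiftAut_neg, map_inv, h]⟩

theorem mem_commonShifts_symm
    {Φ : stabilizedAut G₁ (FullShift A G₁) ≃* stabilizedAut G₂ (FullShift B G₂)}
    {J : AddSubgroup G₁} {J' : AddSubgroup G₂} {v : G₁} (hv : v ∈ commonShifts Φ J J') :
    ∃ w ∈ commonShifts Φ.symm J' J, Φ.symm (shiftAut B w) = shiftAut A v := by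
  obtain ⟨hv, w, hw, h⟩ := hv
  have h1 : Φ.symm (shiftAut B w) = shiftAut A v := by rw [← h, Φ.symm_apply_apply]
  exact ⟨w, ⟨hw, v, hv, h1⟩, h1⟩

theorem finiteIndex_of_forall_exists_nsmul_mem {G : Type*} [AddCommGroup G] [AddGroup.FG G]
    (K : AddSubgroup G) (hK : ∀ v, ∃ n : ℕ, 0 < n ∧ n • v ∈ K) : K.FiniteIndex := by
  have : Finite (G ⧸ K) := by
    refine AddCommGroup.finite_of_fg_isAddTorsion (G ⧸ K) fun t => ?_
    obtain ⟨v, rfl⟩ := QuotientAddGroup.mk_surjective t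
    obtain ⟨n, hn, hnv⟩ := hK v
    exact isOfFinAddOrder_iff_nsmul_eq_zero.2 ⟨n, hn, (QuotientAddGroup.eq_zero_iff _).2 hnv⟩
  exact AddSubgroup.finiteIndex_of_finite_quotient

/-- Commuting with each element up to powers is invariant under `Φ`, so some positive power of each
shift is mapped to a shift. A further multiple enters `J` and `J'`, and a finitely generated torsion
quotient is finite. -/
theorem finiteIndex_commonShifts [Finite B] [Nontrivial B] [AddGroup.FG G₁] [IsAddTorsionFree G₂] [Nontrivial G₂]
    (Φ : stabilizedAut G₁ (FullShift A G₁) ≃* stabilizedAut G₂ (FullShift B G₂))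
    (J : AddSubgroup G₁) (J' : AddSubgroup G₂) [J.FiniteIndex] [J'.FiniteIndex]
    {E : AddSubgroup G₂} [E.FiniteIndex] (hE : 3 ≤ E.index) :
    (commonShifts Φ J J').FiniteIndex := by
  refine finiteIndex_of_forall_exists_nsmul_mem _ fun v => ?_
  obtain ⟨n, hn, w, hw⟩ := exists_pow_eq_shiftAut hE (Φ (shiftAut A v)) fun φ => by
    obtain ⟨n, hn, h⟩ := exists_commute_shiftAut_pow (Φ.symm φ) v
    refine ⟨n, hn, ?_⟩
    have := h.map Φ
    rwa [Φ.apply_symm_apply, map_pow] at this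
  have hJ : 0 < J.index := Nat.pos_of_ne_zero AddSubgroup.FiniteIndex.index_ne_zero
  have hJ' : 0 < J'.index := Nat.pos_of_ne_zero AddSubgroup.FiniteIndex.index_ne_zero
  refine ⟨J.index * J'.index * n, by positivity, ?_, (J.index * J'.index) • w, ?_, ?_⟩
  · rw [mul_assoc, mul_smul]
    exact J.nsmul_index_mem _
  · rw [mul_comm, mul_smul]
    exact J'.nsmul_index_mem _
  · rw [shiftAut_nsmul, map_pow, mul_comm, pow_mul, hw, shiftAut_nsmul]

/-- The homomorphism induced by an isomorphism of stabilized automorphism groups on the automorphisms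
over finite index subgroups. -/
def systemAutMap (Φ : stabilizedAut G₁ (FullShift A G₁) ≃* stabilizedAut G₂ (FullShift B G₂))
    (L : AddSubgroup G₁) (L' : AddSubgroup G₂) [hL : L.FiniteIndex]
    (h : ∀ w ∈ L', ∃ v ∈ L, Φ (shiftAut A v) = shiftAut B w) :
    systemAut (X := FullShift A G₁) L →* systemAut (X := FullShift B G₂) L' :=
  ((stabilizedAut G₂ (FullShift B G₂)).subtype.comp (Φ.toMonoidHom.comp
    (Subgroup.inclusion fun _ hφ => ⟨L, hL, hφ⟩))).codRestrict _ fun φ => by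
      refine mem_systemAut_iff_commute.2 fun w hw => ?_
      obtain ⟨v, hv, hvw⟩ := h w hw
      have h1 : Commute (⟨φ.1, L, hL, φ.2⟩ : stabilizedAut G₁ (FullShift A G₁)) (shiftAut A v) :=
        Subtype.ext (mem_systemAut_iff_commute.1 φ.2 v hv).eq
      have h2 := h1.map Φ
      rw [hvw] at h2
      exact h2.map (stabilizedAut G₂ (FullShift B G₂)).subtype

theorem card_pow_index_le_of_mulEquiv [Finite A] [Nontrivial A] [Finite B]
    (Φ : stabilizedAut G₁ (FullShift A G₁) ≃* stabilizedAut G₂ (FullShift B G₂))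
    {E L : AddSubgroup G₁} {L' : AddSubgroup G₂} [L.FiniteIndex] [L'.FiniteIndex]
    (h : ∀ w ∈ L', ∃ v ∈ L, Φ (shiftAut A v) = shiftAut B w) (hLE : L ≤ E) (hL : 3 ≤ L.index)
    (π : Equiv.Perm A) (g₀ : G₁) {s : stabilizedAut G₁ (FullShift A G₁)}
    (hs : s.1 = balancedGate E π g₀) {x : FullShift B G₂} (hx : ∀ g ∈ L', g +ᵥ x = x)
    (hsx : (Φ s).1 x ≠ x) : Nat.card A ^ L.index ≤ Nat.card B ^ L'.index := by
  have hsL : s.1 ∈ systemAut L := by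
    rw [hs]
    exact fun g hg => balancedGate_mem_systemAut E π g₀ g (hLE hg)
  refine (card_pow_index_le hLE hL π g₀ ((fixAction B L').comp (systemAutMap Φ L L' h))
    (s := ⟨s.1, hsL⟩) hs fun h1 => hsx ?_).trans (card_fix_le L')
  exact congrArg Subtype.val (congrArg (fun σ : Equiv.Perm (Fix B L') => σ ⟨x, hx⟩) h1)

/-- A nontrivial balanced gate, the cosets that it respects, and a period of a point that is moved by
its image under an isomorphism. -/
theorem exists_balancedGate_moving [Nontrivial A] [Nonempty B]
    (hres₁ : ∀ v : G₁, v ≠ 0 → ∃ H : AddSubgroup G₁, H.FiniteIndex ∧ v ∉ H)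
    (hres₂ : ∀ v : G₂, v ≠ 0 → ∃ H : AddSubgroup G₂, H.FiniteIndex ∧ v ∉ H)
    [IsAddTorsionFree G₁] [Nontrivial G₁]
    (Φ : stabilizedAut G₁ (FullShift A G₁) ≃* stabilizedAut G₂ (FullShift B G₂)) :
    ∃ (E : AddSubgroup G₁) (M : AddSubgroup G₂) (π : Equiv.Perm A) (g₀ : G₁)
      (s : stabilizedAut G₁ (FullShift A G₁)) (x : FullShift B G₂),
      E.FiniteIndex ∧ M.FiniteIndex ∧ 3 ≤ E.index ∧ s.1 = balancedGate E π g₀ ∧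
      (∀ g ∈ M, g +ᵥ x = x) ∧ (Φ s).1 x ≠ x := by
  classical
  obtain ⟨E, hE, hE3⟩ := exists_finiteIndex_three_le_index hres₁
  obtain ⟨g₀, hg₀⟩ : ∃ g₀, g₀ ∉ E := by
    by_contra! hall
    have : E = ⊤ := (AddSubgroup.eq_top_iff' E).2 hall
    rw [this, AddSubgroup.index_top] at hE3
    omega
  obtain ⟨a, b, hab⟩ := exists_pair_ne A
  let s : stabilizedAut G₁ (FullShift A G₁) :=
    ⟨balancedGate E (Equiv.swap a b) g₀, E, hE, balancedGate_mem_systemAut _ _ _⟩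
  have hs : s ≠ 1 := fun h =>
    balancedGate_ne_one (mt Equiv.swap_eq_one_iff.1 hab) hg₀ (congrArg Subtype.val h)
  have hΦs : (Φ s).1 ≠ 1 := fun h => hs ((map_eq_one_iff Φ Φ.injective).1 (Subtype.ext h))
  obtain ⟨M, hM, x, hx, hmove⟩ := exists_periodic_ne hres₂ hΦs
  exact ⟨E, M, Equiv.swap a b, g₀, s, x, hE, hM, hE3, rfl, hx, hmove⟩

/-- An isomorphism of stabilized automorphism groups identifies finite index subgroups of the groups
of shifts, in such a way that there are equally many patterns on the quotients. -/
theorem exists_of_mulEquiv [Finite A] [Nontrivial A] [Finite B] [Nontrivial B]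
    [AddGroup.FG G₁] [AddGroup.FG G₂]
    [IsAddTorsionFree G₁] [Nontrivial G₁] [IsAddTorsionFree G₂] [Nontrivial G₂]
    (hres₁ : ∀ v : G₁, v ≠ 0 → ∃ H : AddSubgroup G₁, H.FiniteIndex ∧ v ∉ H)
    (hres₂ : ∀ v : G₂, v ≠ 0 → ∃ H : AddSubgroup G₂, H.FiniteIndex ∧ v ∉ H)
    (Φ : stabilizedAut G₁ (FullShift A G₁) ≃* stabilizedAut G₂ (FullShift B G₂)) :
    ∃ (L : AddSubgroup G₁) (L' : AddSubgroup G₂), L.FiniteIndex ∧ L'.FiniteIndex ∧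
      (∀ v ∈ L, ∃ w, Φ (shiftAut A v) = shiftAut B w) ∧
      (∀ w ∈ L', ∃ v, Φ.symm (shiftAut B w) = shiftAut A v) ∧
      Nat.card A ^ L.index = Nat.card B ^ L'.index := by
  -- Gates and moved points for both directions are fixed before the subgroups, which can then be
  -- taken inside `E ⊓ M` and `E' ⊓ M'`.
  obtain ⟨E, M', π, g₀, s, x, hE, hM', hE3, hs, hx, hsx⟩ :=
    exists_balancedGate_moving hres₁ hres₂ Φ
  obtain ⟨E', M, π', g₀', s', x', hE', hM, hE3', hs', hx', hsx'⟩ :=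
    exists_balancedGate_moving hres₂ hres₁ Φ.symm
  have hL : (commonShifts Φ (E ⊓ M) (E' ⊓ M')).FiniteIndex := finiteIndex_commonShifts _ _ _ hE3'
  have hL' : (commonShifts Φ.symm (E' ⊓ M') (E ⊓ M)).FiniteIndex :=
    finiteIndex_commonShifts _ _ _ hE3
  have hLE : commonShifts Φ (E ⊓ M) (E' ⊓ M') ≤ E ⊓ M := fun v hv => hv.1
  have hLE' : commonShifts Φ.symm (E' ⊓ M') (E ⊓ M) ≤ E' ⊓ M' := fun v hv => hv.1
  refine ⟨_, _, hL, hL', fun v hv => ⟨_, hv.2.choose_spec.2⟩, fun v hv => ⟨_, hv.2.choose_spec.2⟩,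
    le_antisymm ?_ ?_⟩
  · exact card_pow_index_le_of_mulEquiv Φ (fun w hw => mem_commonShifts_symm hw)
      (hLE.trans inf_le_left) (hE3.trans (index_le_index_of_le (hLE.trans inf_le_left))) π g₀ hs
      (fun g hg => hx g (hLE' hg).2) hsx
  · exact card_pow_index_le_of_mulEquiv Φ.symm (fun w hw => mem_commonShifts_symm hw)
      (hLE'.trans inf_le_left) (hE3'.trans (index_le_index_of_le (hLE'.trans inf_le_left))) π' g₀' hs'
      (fun g hg => hx' g (hLE hg).2) hsx'

end Forward

/-! ### Invariance of the dimension -/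

section Rank

variable {A B : Type*} {d₁ d₂ : ℕ}

theorem exists_finiteIndex_notMem {d : ℕ} (v : Fin d → ℤ) (hv : v ≠ 0) :
    ∃ H : AddSubgroup (Fin d → ℤ), H.FiniteIndex ∧ v ∉ H := by
  obtain ⟨i, hi⟩ := Function.ne_iff.1 hv
  -- The modulus exceeds the nonzero |v i|, so it cannot divide `v i`.
  let f : (Fin d → ℤ) →+ ZMod ((v i).natAbs + 1) :=
    (Int.castAddHom _).comp (Pi.evalAddMonoidHom (fun _ => ℤ) i)
  refine ⟨f.ker, inferInstance, fun h => ?_⟩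
  have h1 : ((v i : ℤ) : ZMod ((v i).natAbs + 1)) = 0 := h
  have h2 := Int.natAbs_dvd_natAbs.2 ((ZMod.intCast_zmod_eq_zero_iff_dvd _ _).1 h1)
  have h3 := Nat.le_of_dvd (Int.natAbs_pos.2 hi) h2
  rw [Int.natAbs_natCast] at h3
  omega

/-- If an isomorphism maps a finite index subgroup of the shifts to shifts, then the dimension does
not drop. -/
theorem rank_le_of_mulEquiv [Nontrivial A] [Nontrivial B]
    (Φ : stabilizedAut (Fin d₁ → ℤ) (FullShift A (Fin d₁ → ℤ)) ≃*
      stabilizedAut (Fin d₂ → ℤ) (FullShift B (Fin d₂ → ℤ)))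
    {L : AddSubgroup (Fin d₁ → ℤ)} (hL : L.FiniteIndex)
    (h : ∀ v ∈ L, ∃ w, Φ (shiftAut A v) = shiftAut B w) : d₁ ≤ d₂ := by
  -- Multiplication by the index lands in `L`, so the induced map is defined on the whole lattice.
  choose w hw using fun v : Fin d₁ → ℤ => h _ (L.nsmul_index_mem v)
  let f : (Fin d₁ → ℤ) →+ (Fin d₂ → ℤ) := AddMonoidHom.mk' w fun v v' => by
    apply shiftAut_injective (A := B)
    rw [shiftAut_add, ← hw, ← hw, ← hw, smul_add, shiftAut_add, map_mul]
  have hf : Function.Injective f := by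
    intro v v' hvv
    have h1 : shiftAut A (L.index • v) = shiftAut A (L.index • v') := by
      apply Φ.injective
      rw [hw, hw]
      exact congrArg _ hvv
    exact smul_right_injective _ hL.index_ne_zero (shiftAut_injective h1)
  have := LinearMap.finrank_le_finrank_of_injective (f := f.toIntLinearMap) hf
  simpa using this

end Rank

end FullShift

namespace FullShift

/-! ### The converse: equivariant homeomorphisms over sublattices -/

section Backward

/-- If `φ` commutes with `K`, its conjugate commutes with the image of `K ∩ H` under `α`, which
contains a fixed multiple of every vector. -/
theorem conj_mem_stabilizedAut {G G' X Y : Type*} [AddCommGroup G] [AddCommGroup G']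
    [AddGroup.FG G'] [TopologicalSpace X] [TopologicalSpace Y] [AddAction G X] [AddAction G' Y]
    {H : AddSubgroup G} {H' : AddSubgroup G'} [H'.FiniteIndex] (α : H ≃+ H') (θ : X ≃ₜ Y)
    (hθ : ∀ (h : H) x, θ ((h : G) +ᵥ x) = (α h : G') +ᵥ θ x) {φ : X ≃ₜ X}
    (hφ : φ ∈ stabilizedAut G X) : (θ.symm.trans φ).trans θ ∈ stabilizedAut G' Y := by
  obtain ⟨K, hK, hφ⟩ := hφ
  refine ⟨((K.addSubgroupOf H).map α.toAddMonoidHom).map H'.subtype,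
    finiteIndex_of_forall_exists_nsmul_mem _ fun v => ?_, ?_⟩
  · have h1 := Nat.pos_of_ne_zero hK.index_ne_zero
    have h2 := Nat.pos_of_ne_zero (AddSubgroup.FiniteIndex.index_ne_zero (H := H'))
    refine ⟨K.index * H'.index, by positivity, K.index • ⟨H'.index • v, H'.nsmul_index_mem v⟩,
      ⟨K.index • α.symm ⟨H'.index • v, H'.nsmul_index_mem v⟩, ?_, ?_⟩, ?_⟩
    · exact K.nsmul_index_mem _
    · change α (K.index • α.symm _) = _
      rw [map_nsmul, α.apply_symm_apply]
    · rw [mul_smul]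
      rfl
  · rintro _ ⟨_, ⟨h, hh, rfl⟩, rfl⟩ y
    change θ (φ (θ.symm ((α h : G') +ᵥ y))) = (α h : G') +ᵥ θ (φ (θ.symm y))
    have h1 : θ.symm ((α h : G') +ᵥ y) = (h : G) +ᵥ θ.symm y := by
      rw [θ.symm_apply_eq, hθ, θ.apply_symm_apply]
    rw [h1, hφ (h : G) hh, hθ]

/-- A homeomorphism that is equivariant over finite index subgroups induces an isomorphism of
stabilized automorphism groups. -/
def stabilizedAutCongr {G G' X Y : Type*} [AddCommGroup G] [AddCommGroup G'] [AddGroup.FG G]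
    [AddGroup.FG G'] [TopologicalSpace X] [TopologicalSpace Y] [AddAction G X] [AddAction G' Y]
    {H : AddSubgroup G} {H' : AddSubgroup G'} [H.FiniteIndex] [H'.FiniteIndex] (α : H ≃+ H')
    (θ : X ≃ₜ Y) (hθ : ∀ (h : H) x, θ ((h : G) +ᵥ x) = (α h : G') +ᵥ θ x) :
    stabilizedAut G X ≃* stabilizedAut G' Y where
  toFun φ := ⟨(θ.symm.trans φ.1).trans θ, conj_mem_stabilizedAut α θ hθ φ.2⟩
  invFun ψ := ⟨(θ.trans ψ.1).trans θ.symm, conj_mem_stabilizedAut α.symm θ.symm (fun h y => by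
    rw [θ.symm_apply_eq, hθ, α.apply_symm_apply, θ.apply_symm_apply]) ψ.2⟩
  left_inv φ := Subtype.ext <| Homeomorph.ext fun x => by simp
  right_inv ψ := Subtype.ext <| Homeomorph.ext fun x => by simp
  map_mul' φ ψ := Subtype.ext <| Homeomorph.ext fun x => by
    change θ (φ.1 (ψ.1 (θ.symm x))) = θ (φ.1 (θ.symm (θ (ψ.1 (θ.symm x)))))
    rw [θ.symm_apply_apply]

/-- Renaming the symbols and the cells of configurations. -/
def reindex {C D L L' : Type*} (e : C ≃ D) (α : L ≃ L') : FullShift C L ≃ₜ FullShift D L' where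
  toEquiv := α.arrowCongr e
  continuous_toFun := continuous_of_cell α.symm fun _ _ _ h => congrArg e h
  continuous_invFun := continuous_of_cell α fun _ _ _ h => congrArg e.symm h

/-- Regrouped over `L` and `L'`, the two systems differ only in the names of symbols and cells. -/
theorem nonempty_mulEquiv_of_addEquiv {A B G : Type*} [AddCommGroup G] [AddGroup.FG G] [Finite A]
    [Finite B] {L L' : AddSubgroup G} [L.FiniteIndex] [L'.FiniteIndex] (α : L ≃+ L')
    (h : Nat.card A ^ L.index = Nat.card B ^ L'.index) :
    Nonempty (stabilizedAut G (FullShift A G) ≃* stabilizedAut G (FullShift B G)) := by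
  have hcard : Nat.card (G ⧸ L → A) = Nat.card (G ⧸ L' → B) := by
    rw [Nat.card_fun, Nat.card_fun]
    exact h
  let e : (G ⧸ L → A) ≃ (G ⧸ L' → B) :=
    (Finite.equivFinOfCardEq hcard).trans (Finite.equivFin _).symm
  refine ⟨stabilizedAutCongr α
    (((regroupHomeo A L).trans (reindex e α.toEquiv)).trans (regroupHomeo B L').symm)
    fun l x => ?_⟩
  change (regroupHomeo B L').symm (reindex e α.toEquiv (regroupHomeo A L ((l : G) +ᵥ x))) =
    (α l : G) +ᵥ (regroupHomeo B L').symm (reindex e α.toEquiv (regroupHomeo A L x))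
  rw [regroupHomeo_vadd, ← regroupHomeo_symm_vadd]
  congr 1
  funext m
  change e (regroupHomeo A L x (α.symm m + l)) = e (regroupHomeo A L x (α.symm (m + α l)))
  rw [map_add, α.symm_apply_apply]

/-- The map that multiplies the coordinate `i` by `m`. -/
def scaleCoord {d : ℕ} (i : Fin d) (m : ℕ) : (Fin d → ℤ) →+ (Fin d → ℤ) :=
  AddMonoidHom.mk' (fun v j => if j = i then m * v j else v j) fun v w => by
    funext j
    by_cases hj : j = i <;> simp [hj, mul_add]

theorem scaleCoord_injective {d : ℕ} (i : Fin d) {m : ℕ} (hm : m ≠ 0) :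
    Function.Injective (scaleCoord i m) := by
  intro v w h
  funext j
  have h1 : (if j = i then (m : ℤ) * v j else v j) = if j = i then (m : ℤ) * w j else w j :=
    congrFun h j
  by_cases hj : j = i
  · rw [if_pos hj, if_pos hj] at h1
    exact mul_left_cancel₀ (by exact_mod_cast hm) h1
  · rwa [if_neg hj, if_neg hj] at h1

/-- The range is the kernel of the surjection that reduces coordinate `i` modulo `m`. -/
theorem index_range_scaleCoord {d : ℕ} (i : Fin d) (m : ℕ) : (scaleCoord i m).range.index = m := by
  let f : (Fin d → ℤ) →+ ZMod m := (Int.castAddHom _).comp (Pi.evalAddMonoidHom (fun _ => ℤ) i)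
  have hf : Function.Surjective f := fun z => by
    obtain ⟨k, hk⟩ := ZMod.intCast_surjective z
    exact ⟨fun _ => k, hk⟩
  have hrange : (scaleCoord i m).range = f.ker := by
    ext v
    have hv : v ∈ f.ker ↔ (m : ℤ) ∣ v i := ZMod.intCast_zmod_eq_zero_iff_dvd _ _
    rw [hv]
    constructor
    · rintro ⟨w, rfl⟩
      exact ⟨w i, if_pos rfl⟩
    · rintro ⟨k, hk⟩
      refine ⟨fun j => if j = i then k else v j, funext fun j => ?_⟩
      change (if j = i then (m : ℤ) * (if j = i then k else v j) else if j = i then k else v j) = v j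
      by_cases hj : j = i
      · rw [if_pos hj, if_pos hj, hj, hk]
      · rw [if_neg hj, if_neg hj]
  rw [hrange, AddSubgroup.index_ker, AddMonoidHom.range_eq_top.2 hf]
  simp

theorem nonempty_mulEquiv_of_card_pow_eq {A B : Type*} [Finite A] [Finite B] {d : ℕ} (hd : 1 ≤ d)
    {m n : ℕ} (hm : m ≠ 0) (hn : n ≠ 0) (h : Nat.card A ^ m = Nat.card B ^ n) :
    Nonempty (stabilizedAut (Fin d → ℤ) (FullShift A (Fin d → ℤ)) ≃*
      stabilizedAut (Fin d → ℤ) (FullShift B (Fin d → ℤ))) := by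
  let i : Fin d := ⟨0, hd⟩
  have hmi := index_range_scaleCoord i m
  have hni := index_range_scaleCoord i n
  have : (scaleCoord i m).range.FiniteIndex := ⟨by rwa [hmi]⟩
  have : (scaleCoord i n).range.FiniteIndex := ⟨by rwa [hni]⟩
  exact nonempty_mulEquiv_of_addEquiv
    ((AddMonoidHom.ofInjective (scaleCoord_injective i hm)).symm.trans
      (AddMonoidHom.ofInjective (scaleCoord_injective i hn))) (by rw [hmi, hni, h])

end Backward

end FullShift

theorem mainTheorem6 {A B : Type*} [Finite A] [Finite B]
    (hA : 2 ≤ Nat.card A) (hB : 2 ≤ Nat.card B)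
    (d₁ d₂ : ℕ) (hd₁ : 1 ≤ d₁) (hd₂ : 1 ≤ d₂) :
    Nonempty (stabilizedAut (Fin d₁ → ℤ) (FullShift A (Fin d₁ → ℤ)) ≃*
        stabilizedAut (Fin d₂ → ℤ) (FullShift B (Fin d₂ → ℤ))) ↔
      d₁ = d₂ ∧ ∃ m n : ℕ, 1 ≤ m ∧ 1 ≤ n ∧ Nat.card A ^ m = Nat.card B ^ n := by
  constructor
  · rintro ⟨Φ⟩
    have : Nontrivial A := Finite.one_lt_card_iff_nontrivial.1 hA
    have : Nontrivial B := Finite.one_lt_card_iff_nontrivial.1 hB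
    have : Nonempty (Fin d₁) := ⟨⟨0, hd₁⟩⟩
    have : Nonempty (Fin d₂) := ⟨⟨0, hd₂⟩⟩
    obtain ⟨L, L', hL, hL', h, h', hcard⟩ :=
      FullShift.exists_of_mulEquiv FullShift.exists_finiteIndex_notMem
        FullShift.exists_finiteIndex_notMem Φ
    exact ⟨le_antisymm (FullShift.rank_le_of_mulEquiv Φ hL h)
        (FullShift.rank_le_of_mulEquiv Φ.symm hL' h'),
      L.index, L'.index, Nat.one_le_iff_ne_zero.2 hL.index_ne_zero,
      Nat.one_le_iff_ne_zero.2 hL'.index_ne_zero, hcard⟩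
  · rintro ⟨rfl, m, n, hm, hn, h⟩
    exact FullShift.nonempty_mulEquiv_of_card_pow_eq hd₁ (Nat.one_le_iff_ne_zero.1 hm)
      (Nat.one_le_iff_ne_zero.1 hn) h
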